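/- Let $\mathcal I$ be a finite set of index pairs $(i,j)$ with $n$ elements (for example a run-off triangle), let $X\in\mathbb R^{n\times p}$ be a design matrix with rows $X_{ij}'$, $(i,j)\in\mathcal I$, and let $\xi\in\mathbb R^p$; $\mathcal I$, $X$ and $\xi$ are fixed. Assume that $\xi$ is identified by the normal likelihood $$\ell(\xi,\omega^2)=-\tfrac n2\log(2\pi\omega^2)-\tfrac1{2\omega^2}\sum_{(i,j)\in\mathcal I}(y_{ij}-X_{ij}'\xi)^2 ,$$ that is, $X$ has full column rank. Consider a family of arrays $Y=(Y_{ij})_{(i,j)\in\mathcal I}$ of real random variables with finite third moments, with scale parameters $\omega>0$ and $\omega^2\to0$, such that (a) for each member of the family the $Y_{ij}$ are independent, non-negative and infinitely divisible (for every $m\ge1$, $Y_{ij}$ is distributed as a sum of $m$ independent, identically distributed variables); (b) $\mathsf E\,Y_{ij}>0$ and $\log\mathsf E\,Y_{ij}=X_{ij}'\xi+\omega^2/2$; (c) as $\omega^2\to0$, for every $(i,j)\in\mathcal I$, $\ \mathsf E\big[\{(Y_{ij}-\mathsf E Y_{ij})/\sqrt{\mathsf{Var}\,Y_{ij}}\}^3\big]\to0$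 and $\ \mathsf{Var}(Y_{ij})/\{\omega^2(\mathsf E Y_{ij})^2\}\to1$. Let $y_{ij}=\log Y_{ij}$ (with an arbitrary fixed real value, say $0$, when $Y_{ij}=0$), let $\hat\xi=(X'X)^{-1}X'y$ be the least squares estimator, and, if $n>p$, let $s^2=\frac1{n-p}\sum_{(i,j)\in\mathcal I}(y_{ij}-X_{ij}'\hat\xi)^2$. Then, as $\omega^2\to0$, $$\omega^{-1}(\hat\xi-\xi)\ \xrightarrow{\mathsf D}\ \mathsf N\{0,(X'X)^{-1}\},$$ and, if $n>p$, $$\omega^{-2}s^2\ \xrightarrow{\mathsf D}\ \chi^2_{n-p}/(n-p).$$ Moreover, if $n>p$, the two converge jointly and are asymptotically independent: the pair $(\omega^{-1}(\hat\xi-\xi),\ \omega^{-2}s^2)$ converges in distribution to the product of these two limit laws. -/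

import Mathlib

open MeasureTheory ProbabilityTheory Filter Matrix
open scoped Topology

namespace GLN

noncomputable section

/-- A distribution `D` on `ℝ` is infinitely divisible if for every `m ≥ 1` it is the law of a sum
of `m` independent, identically distributed random variables (with common law `ν`). -/
def InfinitelyDivisible (D : Measure ℝ) : Prop :=
  ∀ m : ℕ, 0 < m → ∃ ν : Measure ℝ, IsProbabilityMeasure ν ∧
    (Measure.pi (fun _ : Fin m => ν)).map (fun x => ∑ i, x i) = D

/-- The skewness `E [{(Y - E Y) / sdv Y}³]`. -/
def skewness {Ω : Type*} [MeasurableSpace Ω] (Y : Ω → ℝ) (P : Measure Ω) : ℝ :=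
  ∫ w, ((Y w - ∫ w', Y w' ∂P) / √(variance Y P)) ^ 3 ∂P

/-- The `χ²` distribution with `d` degrees of freedom: the law of the sum of squares of `d`
independent standard normal variables. -/
def chiSquared (d : ℕ) : Measure ℝ :=
  (Measure.pi (fun _ : Fin d => gaussianReal 0 1)).map (fun x => ∑ i, x i ^ 2)

instance (d : ℕ) : IsProbabilityMeasure (chiSquared d) :=
  Measure.isProbabilityMeasure_map (Measurable.aemeasurable (by fun_prop))

/-- The distribution `χ²_d / d`. -/
def chiSquaredDiv (d : ℕ) : Measure ℝ := (chiSquared d).map (fun x => x / d)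

instance (d : ℕ) : IsProbabilityMeasure (chiSquaredDiv d) :=
  Measure.isProbabilityMeasure_map (Measurable.aemeasurable (by fun_prop))

section LeastSquares

variable {I : Finset (ℕ × ℕ)} {p : ℕ}

/-- The normal log likelihood of the log observations `y`, at predictor parameter `ξ` and
variance `v = ω²`. -/
def logLikelihood (X : Matrix I (Fin p) ℝ) (y : I → ℝ) (ξ : Fin p → ℝ) (v : ℝ) : ℝ :=
  -((I.card : ℝ) / 2) * Real.log (2 * Real.pi * v)
    - 1 / (2 * v) * ∑ ij, (y ij - (X *ᵥ ξ) ij) ^ 2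

/-- `ξ` is identified by the normal likelihood: different values of `ξ ∈ ℝᵖ` have different
likelihood functions. (This says that the design matrix `X` has full column rank.) -/
def Identified (X : Matrix I (Fin p) ℝ) : Prop :=
  ∀ ξ ξ' : Fin p → ℝ,
    (∀ (y : I → ℝ) (v : ℝ), 0 < v → logLikelihood X y ξ v = logLikelihood X y ξ' v) → ξ = ξ'

/-- The least squares estimator `ξ̂ = (X'X)⁻¹ X'y`. -/
def lsEstimator (X : Matrix I (Fin p) ℝ) (y : I → ℝ) : Fin p → ℝ :=
  (Xᵀ * X)⁻¹ *ᵥ (Xᵀ *ᵥ y)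

/-- The residuals `ε̂ᵢⱼ = yᵢⱼ - Xᵢⱼ' ξ̂`. -/
def residual (X : Matrix I (Fin p) ℝ) (y : I → ℝ) (ij : I) : ℝ :=
  y ij - (X *ᵥ lsEstimator X y) ij

/-- The residual sum of squares. -/
def rss (X : Matrix I (Fin p) ℝ) (y : I → ℝ) : ℝ := ∑ ij, residual X y ij ^ 2

/-- The variance estimator `s² = RSS / (n - p)`, where `n` is the number of observations. -/
def sSquared (X : Matrix I (Fin p) ℝ) (y : I → ℝ) : ℝ := rss X y / ((I.card : ℝ) - (p : ℝ))

end LeastSquares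

/-- The infinitely divisible setup for a family of arrays `Y t = (Y t i j)`, `(i, j) ∈ I`, whose
index set `I` does not depend on the index `t` along which limits are taken (filter `l`). -/
structure InfDivArray {T : Type*} (l : Filter T) {I : Finset (ℕ × ℕ)}
    {Ω : T → Type*} [∀ t, MeasurableSpace (Ω t)] (P : (t : T) → Measure (Ω t))
    (Y : (t : T) → I → Ω t → ℝ) : Prop where
  aemeasurable : ∀ t ij, AEMeasurable (Y t ij) (P t)
  indep : ∀ t, iIndepFun (Y t) (P t)
  nonneg : ∀ t ij, ∀ᵐ w ∂(P t), 0 ≤ Y t ij w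
  infDiv : ∀ t ij, InfinitelyDivisible ((P t).map (Y t ij))
  /-- Third moments are finite, so that the skewness is meaningful. -/
  memLp_three : ∀ t ij, MemLp (Y t ij) 3 (P t)
  skewness_tendsto : ∀ ij, Tendsto (fun t => skewness (Y t ij) (P t)) l (𝓝 0)

/-- The generalized log-normal model with design matrix `X` (rows `Xᵢⱼ'`), fixed parameter `ξ`
and scale parameter `ω t > 0` with `(ω t)² → 0` along `l`. -/
structure GeneralizedLogNormal {T : Type*} (l : Filter T) {I : Finset (ℕ × ℕ)} {p : ℕ}
    (X : Matrix I (Fin p) ℝ) (ξ : Fin p → ℝ) (ω : T → ℝ)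
    {Ω : T → Type*} [∀ t, MeasurableSpace (Ω t)] (P : (t : T) → Measure (Ω t))
    (Y : (t : T) → I → Ω t → ℝ) : Prop extends InfDivArray l P Y where
  identified : Identified X
  mean_pos : ∀ t ij, 0 < ∫ w, Y t ij w ∂(P t)
  log_mean : ∀ t ij, Real.log (∫ w, Y t ij w ∂(P t)) = (X *ᵥ ξ) ij + ω t ^ 2 / 2
  omega_pos : ∀ t, 0 < ω t
  omega_tendsto : Tendsto (fun t => ω t ^ 2) l (𝓝 0)
  variance_tendsto : ∀ ij, Tendsto
    (fun t => variance (Y t ij) (P t) / (ω t ^ 2 * (∫ w, Y t ij w ∂(P t)) ^ 2)) l (𝓝 1)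

/-- The log observations `yᵢⱼ = log Yᵢⱼ`. -/
def logData {Ω : Type*} {I : Finset (ℕ × ℕ)} (Y : I → Ω → ℝ) (w : Ω) : I → ℝ :=
  fun ij => Real.log (Y ij w)

end

end GLN

/-! The core is a quantitative central limit theorem, `norm_charFun_centred_sub_exp_le`. Write a
non-negative infinitely divisible law with mean `μ` and third centred moment `κ` as a sum of `m`
i.i.d. pieces. The pieces are again non-negative, with mean `μ/m` and third centred moment `κ/m`.
Non-negativity bounds their absolute third centred moment by `κ/m + 2(μ/m)^3`. Taylor expansion and
comparison of `m`-th powers, followed by `m → ∞`, leave an error `4|t|^3 κ` from the centred normal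
characteristic function. After normalization `κ` becomes the skewness, which tends to zero.

A delta-method argument (`tendsto_charFun_log`) then shows that each error `ω⁻¹(y - X'ξ)` tends to a
standard normal, and independence gives a standard Gaussian vector. Least squares is equivariant, so
both statistics are continuous functions of this error vector. The continuous mapping theorem
reduces the claim to exact normal theory: `map_stdGaussian_lsEstimator_prod` and
`map_norm_sq_stdGaussian`. -/

namespace GLN

/-! ### Elementary complex inequalities. -/

/-- Second order Taylor bound for the exponential on the imaginary axis. -/
lemma norm_exp_mul_I_sub_le (x : ℝ) :
    ‖Complex.exp (x * Complex.I) - (1 + x * Complex.I - x ^ 2 / 2)‖ ≤ 4 * |x| ^ 3 := by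
  have hI : (x * Complex.I : ℂ) ^ 2 = -(x : ℂ) ^ 2 := by
    rw [mul_pow, Complex.I_sq]; ring
  have hn : ‖(x * Complex.I : ℂ)‖ = |x| := by simp
  rcases le_total |x| 1 with h | h
  · have := Complex.exp_bound (x := x * Complex.I) (by rwa [hn]) (n := 3) (by norm_num)
    simp only [Finset.sum_range_succ, Finset.sum_range_zero, hn, hI] at this
    have h3 : 0 ≤ |x| ^ 3 := by positivity
    have e : Complex.exp (x * Complex.I) - (1 + x * Complex.I - x ^ 2 / 2)
        = Complex.exp (x * Complex.I) - (0 + (x * Complex.I) ^ 0 / (Nat.factorial 0 : ℕ)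
          + (x * Complex.I) ^ 1 / (Nat.factorial 1 : ℕ) + -(x : ℂ) ^ 2 / (Nat.factorial 2 : ℕ)) := by
      simp [Nat.factorial]; ring
    rw [e]
    refine this.trans ?_
    norm_num [Nat.factorial]
    nlinarith
  -- Here the triangle inequality gives `2 + |x| + |x|²/2 ≤ 3.5 |x|³`; this range dictates the
  -- constant 4.
  · have h1 : ‖Complex.exp (x * Complex.I)‖ = 1 := Complex.norm_exp_ofReal_mul_I x
    have h2 : ‖(x : ℂ) ^ 2 / 2‖ = |x| ^ 2 / 2 := by simp
    have h3 : ‖Complex.exp (x * Complex.I) - (1 + x * Complex.I - x ^ 2 / 2)‖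
        ≤ 1 + (1 + |x| + |x| ^ 2 / 2) := by
      refine (norm_sub_le _ _).trans ?_
      rw [h1]
      gcongr
      refine (norm_sub_le _ _).trans ?_
      rw [h2]
      gcongr
      refine (norm_add_le _ _).trans ?_
      rw [hn]; simp
    have h4 : |x| ≤ |x| ^ 3 := le_self_pow₀ h (by norm_num)
    have h5 : |x| ^ 2 ≤ |x| ^ 3 := pow_le_pow_right₀ h (by norm_num)
    linarith

/-- Telescoping. The factor `m` will be cancelled by the third moment of one of `m` i.i.d. pieces,
which is of order `1/m`. -/
lemma norm_pow_sub_pow_le_of_norm_le_one {a b : ℂ} (ha : ‖a‖ ≤ 1) (hb : ‖b‖ ≤ 1) (m : ℕ) :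
    ‖a ^ m - b ^ m‖ ≤ m * ‖a - b‖ := by
  induction m with
  | zero => simp
  | succ m ih =>
    have e : a ^ (m + 1) - b ^ (m + 1) = a * (a ^ m - b ^ m) + (a - b) * b ^ m := by ring
    rw [e]
    refine (norm_add_le _ _).trans ?_
    rw [norm_mul, norm_mul, norm_pow]
    have h1 : ‖a‖ * ‖a ^ m - b ^ m‖ ≤ ‖a ^ m - b ^ m‖ :=
      mul_le_of_le_one_left (norm_nonneg _) ha
    have h2 : ‖a - b‖ * ‖b‖ ^ m ≤ ‖a - b‖ :=
      mul_le_of_le_one_right (norm_nonneg _) (pow_le_one₀ (norm_nonneg _) hb)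
    push_cast
    linarith

/-! ### Third moments and characteristic functions. -/

section Moments

variable {Ω : Type*} [MeasurableSpace Ω] {P : Measure Ω} [IsProbabilityMeasure P]

lemma integrable_pow_of_memLp_three {X : Ω → ℝ} (hX : MemLp X 3 P) {k : ℕ} (hk : k ≤ 3) :
    Integrable (fun w => X w ^ k) P := by
  have h : MemLp X (k : ℕ) P := hX.mono_exponent (by exact_mod_cast hk)
  refine (h.integrable_norm_pow').mono' (hX.aestronglyMeasurable.pow k) ?_
  simp

lemma integrable_abs_pow_three {X : Ω → ℝ} (hX : MemLp X 3 P) :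
    Integrable (fun w => |X w| ^ 3) P := by
  simpa using (integrable_pow_of_memLp_three hX le_rfl).abs

/-- Second order Taylor bound for the characteristic function of a centred variable. -/
lemma norm_charFun_sub_le {X : Ω → ℝ} (hX : MemLp X 3 P) (h0 : ∫ w, X w ∂P = 0) (t : ℝ) :
    ‖charFun (P.map X) t - (1 - (∫ w, X w ^ 2 ∂P : ℝ) * t ^ 2 / 2)‖
      ≤ 4 * |t| ^ 3 * ∫ w, |X w| ^ 3 ∂P := by
  have hm : AEMeasurable X P := hX.aestronglyMeasurable.aemeasurable
  have h1 : Integrable X P := by simpa using integrable_pow_of_memLp_three hX (k := 1) (by norm_num)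
  have h2 : Integrable (fun w => X w ^ 2) P := integrable_pow_of_memLp_three hX (by norm_num)
  have i1 : Integrable (fun w => ((t * X w : ℝ) : ℂ) * Complex.I) P :=
    ((h1.const_mul t).ofReal (𝕜 := ℂ)).mul_const _
  have i2 : Integrable (fun w => (((t * X w) ^ 2 / 2 : ℝ) : ℂ)) P := by
    refine Integrable.ofReal ?_
    simp_rw [mul_pow]
    exact (h2.const_mul _).div_const _
  have i01 : Integrable (fun w => 1 + ((t * X w : ℝ) : ℂ) * Complex.I) P :=
    (integrable_const _).add i1
  have i012 : Integrable (fun w => 1 + ((t * X w : ℝ) : ℂ) * Complex.I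
      - (((t * X w) ^ 2 / 2 : ℝ) : ℂ)) P := i01.sub i2
  have ie : Integrable (fun w => Complex.exp ((t * X w : ℝ) * Complex.I)) P := by
    refine (integrable_const (1 : ℝ)).mono' (by fun_prop) (ae_of_all _ fun w => ?_)
    rw [Complex.norm_exp_ofReal_mul_I]
  have e1 : charFun (P.map X) t = ∫ w, Complex.exp ((t * X w : ℝ) * Complex.I) ∂P := by
    rw [charFun_apply_real, integral_map hm (by fun_prop)]
    simp
  have e2 : (1 - (∫ w, X w ^ 2 ∂P : ℝ) * t ^ 2 / 2 : ℂ)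
      = ∫ w, (1 + ((t * X w : ℝ) : ℂ) * Complex.I - (((t * X w) ^ 2 / 2 : ℝ) : ℂ)) ∂P := by
    rw [integral_sub i01 i2, integral_add (integrable_const _) i1,
      integral_mul_const, integral_complex_ofReal, integral_const_mul, h0, integral_complex_ofReal]
    simp_rw [mul_pow]
    rw [integral_div, integral_const_mul]
    simp
    ring
  rw [e1, e2, ← integral_sub ie i012, ← integral_const_mul]
  refine norm_integral_le_of_norm_le ((integrable_abs_pow_three hX).const_mul _)
    (ae_of_all _ fun w => ?_)
  have := norm_exp_mul_I_sub_le (t * X w)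
  rw [abs_mul, mul_pow, ← mul_assoc] at this
  simpa using this

/-- The mixed terms factor by independence, and each contains a vanishing mean. -/
lemma integral_add_pow_three {A B : Ω → ℝ} (hA : MemLp A 3 P) (hB : MemLp B 3 P)
    (h : IndepFun A B P) (hA0 : ∫ w, A w ∂P = 0) (hB0 : ∫ w, B w ∂P = 0) :
    ∫ w, (A w + B w) ^ 3 ∂P = ∫ w, A w ^ 3 ∂P + ∫ w, B w ^ 3 ∂P := by
  have a1 : Integrable A P := by simpa using integrable_pow_of_memLp_three hA (k := 1) (by norm_num)
  have b1 : Integrable B P := by simpa using integrable_pow_of_memLp_three hB (k := 1) (by norm_num)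
  have a2 := integrable_pow_of_memLp_three hA (k := 2) (by norm_num)
  have b2 := integrable_pow_of_memLp_three hB (k := 2) (by norm_num)
  have a3 := integrable_pow_of_memLp_three hA (k := 3) le_rfl
  have b3 := integrable_pow_of_memLp_three hB (k := 3) le_rfl
  have hab : IndepFun (fun w => A w ^ 2) B P :=
    h.comp (φ := fun x => x ^ 2) (ψ := id) (by fun_prop) measurable_id
  have hba : IndepFun A (fun w => B w ^ 2) P :=
    h.comp (φ := id) (ψ := fun x => x ^ 2) measurable_id (by fun_prop)
  have iab : Integrable (fun w => A w ^ 2 * B w) P := hab.integrable_mul a2 b1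
  have iba : Integrable (fun w => A w * B w ^ 2) P := hba.integrable_mul a1 b2
  have e : ∀ w, (A w + B w) ^ 3 = A w ^ 3 + 3 * (A w ^ 2 * B w) + 3 * (A w * B w ^ 2) + B w ^ 3 :=
    fun w => by ring
  simp_rw [e]
  have j1 : Integrable (fun w => A w ^ 3 + 3 * (A w ^ 2 * B w)) P := a3.add (iab.const_mul 3)
  have j2 : Integrable (fun w => A w ^ 3 + 3 * (A w ^ 2 * B w) + 3 * (A w * B w ^ 2)) P :=
    j1.add (iba.const_mul 3)
  rw [integral_add j2 b3, integral_add j1 (iba.const_mul 3),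
    integral_add a3 (iab.const_mul 3), integral_const_mul, integral_const_mul,
    hab.integral_fun_mul_eq_mul_integral a2.aestronglyMeasurable b1.aestronglyMeasurable,
    hba.integral_fun_mul_eq_mul_integral a1.aestronglyMeasurable b2.aestronglyMeasurable, hA0, hB0]
  ring

lemma integral_sum_pow_three {ι : Type*} {X : ι → Ω → ℝ} (hX : ∀ i, MemLp (X i) 3 P)
    (h : iIndepFun X P) (h0 : ∀ i, ∫ w, X i w ∂P = 0) (s : Finset ι) :
    ∫ w, (∑ i ∈ s, X i w) ^ 3 ∂P = ∑ i ∈ s, ∫ w, X i w ^ 3 ∂P := by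
  classical
  induction s using Finset.induction with
  | empty => simp
  | insert i s hi ih =>
    simp_rw [Finset.sum_insert hi]
    have hind : IndepFun (X i) (fun w => ∑ j ∈ s, X j w) P := by
      have := (h.indepFun_finsetSum_of_notMem₀
        (fun j => (hX j).aestronglyMeasurable.aemeasurable) hi).symm
      convert this using 1
      ext w; simp
    rw [integral_add_pow_three (hX i) (memLp_finsetSum _ fun j _ => hX j) hind (h0 i), ih]
    rw [integral_finsetSum _ fun j _ => ?_]
    · simp [h0]
    · simpa using integrable_pow_of_memLp_three (hX j) (k := 1) (by norm_num)

end Moments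

/-! ### Normal approximation of infinitely divisible laws. -/

section InfinitelyDivisible

variable {ν : Measure ℝ} [IsProbabilityMeasure ν] {m : ℕ}

/-- If a sum of `m ≥ 1` i.i.d. variables is almost surely non-negative, so is each summand. -/
lemma ae_nonneg_of_map_sum (hm : 0 < m)
    (h : ∀ᵐ x ∂((Measure.pi (fun _ : Fin m => ν)).map (fun x => ∑ i, x i)), 0 ≤ x) :
    ∀ᵐ x ∂ν, 0 ≤ x := by
  have hmeas : Measurable (fun x : Fin m → ℝ => ∑ i, x i) := by fun_prop
  have h' := ae_of_ae_map hmeas.aemeasurable h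
  rw [ae_iff] at h' ⊢
  -- The box of all-negative coordinates has mass `ν(-∞, 0)^m` and lies in a null event.
  have hsub : Set.univ.pi (fun _ : Fin m => {x : ℝ | ¬ 0 ≤ x}) ⊆
      {x : Fin m → ℝ | ¬ 0 ≤ ∑ i, x i} := by
    intro x hx
    simp only [Set.mem_pi, Set.mem_univ, Set.mem_ofPred_eq, not_le, forall_const] at hx ⊢
    have : Nonempty (Fin m) := ⟨⟨0, hm⟩⟩
    exact Finset.sum_neg (fun i _ => hx i) Finset.univ_nonempty
  have := measure_mono_null hsub h'
  rw [Measure.pi_pi, Finset.prod_const] at this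
  exact pow_eq_zero_iff (by simp; lia) |>.1 this

/-- A non-negative summand is dominated by the sum, hence inherits its integrability. -/
lemma memLp_of_map_sum {q : ENNReal} (hm : 0 < m) (hnn : ∀ᵐ x ∂ν, 0 ≤ x)
    (h : MemLp id q ((Measure.pi (fun _ : Fin m => ν)).map (fun x => ∑ i, x i))) :
    MemLp id q ν := by
  set Q := Measure.pi (fun _ : Fin m => ν)
  have hmeas : Measurable (fun x : Fin m → ℝ => ∑ i, x i) := by fun_prop
  have h1 : MemLp (fun x : Fin m → ℝ => ∑ i, x i) q Q :=
    (memLp_map_measure_iff (by fun_prop) hmeas.aemeasurable).1 h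
  have mp (i : Fin m) : MeasurePreserving (Function.eval i) Q ν :=
    measurePreserving_eval (fun _ : Fin m => ν) i
  have hall : ∀ᵐ x ∂Q, ∀ i, 0 ≤ x i :=
    ae_all_iff.2 fun i => (mp i).quasiMeasurePreserving.ae hnn
  have h2 : MemLp (Function.eval (⟨0, hm⟩ : Fin m) : (Fin m → ℝ) → ℝ) q Q := by
    refine h1.mono (measurable_pi_apply _).aestronglyMeasurable ?_
    filter_upwards [hall] with x hx
    rw [Real.norm_of_nonneg (hx _), Real.norm_of_nonneg (Finset.sum_nonneg fun i _ => hx i)]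
    exact Finset.single_le_sum (f := fun i => x i) (fun i _ => hx i) (Finset.mem_univ _)
  have h3 := (mp ⟨0, hm⟩).map_eq
  rw [← h3]
  exact (memLp_map_measure_iff (by fun_prop) (mp _).measurable.aemeasurable).2 h2

lemma integral_map_sum (hν : MemLp id 3 ν) :
    ∫ y, y ∂((Measure.pi (fun _ : Fin m => ν)).map (fun x => ∑ i, x i)) = m * ∫ x, x ∂ν := by
  have i1 : Integrable (fun x : ℝ => x) ν := by
    simpa using integrable_pow_of_memLp_three hν (k := 1) (by norm_num)
  rw [integral_map (by fun_prop) (by fun_prop), integral_finsetSum]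
  · simp [integral_eval]
  · intro i _
    exact integrable_eval i1

/-- The relations between the centred moments and characteristic function of the `m`-fold
convolution power of `ν` and those of `ν`. -/
lemma centred_map_sum (hν : MemLp id 3 ν) :
    let D := (Measure.pi (fun _ : Fin m => ν)).map (fun x => ∑ i, x i)
    ∫ y, (y - ∫ z, z ∂D) ^ 2 ∂D = m * ∫ x, (x - ∫ z, z ∂ν) ^ 2 ∂ν ∧
    ∫ y, (y - ∫ z, z ∂D) ^ 3 ∂D = m * ∫ x, (x - ∫ z, z ∂ν) ^ 3 ∂ν ∧
    ∀ t, charFun (D.map (fun y => y - ∫ z, z ∂D)) t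
      = charFun (ν.map (fun x => x - ∫ z, z ∂ν)) t ^ m := by
  intro D
  set a := ∫ z, z ∂ν with ha
  have hμ : ∫ z, z ∂D = m * a := integral_map_sum hν
  set Q := Measure.pi (fun _ : Fin m => ν) with hQ
  have hmeas : Measurable (fun x : Fin m → ℝ => ∑ i, x i) := by fun_prop
  have mp (i : Fin m) : MeasurePreserving (Function.eval i) Q ν :=
    measurePreserving_eval (fun _ : Fin m => ν) i
  let X : Fin m → (Fin m → ℝ) → ℝ := fun i x => x i - a
  have hsum (x : Fin m → ℝ) : ∑ i, x i - m * a = ∑ i, X i x := by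
    simp [X, Finset.sum_sub_distrib]
  have hνa : MemLp (fun x => x - a) 3 ν := hν.sub (memLp_const a)
  have hX (i : Fin m) : MemLp (X i) 3 Q := hνa.comp_measurePreserving (mp i)
  have hind : iIndepFun X Q :=
    iIndepFun_pi (μ := fun _ : Fin m => ν) (X := fun _ x => x - a) (by fun_prop)
  have i1 : Integrable (fun x : ℝ => x) ν := by
    simpa using integrable_pow_of_memLp_three hν (k := 1) (by norm_num)
  have hint {g : ℝ → ℝ} (hg : Measurable g) (i : Fin m) :
      ∫ x, g (X i x) ∂Q = ∫ x, g (x - a) ∂ν := by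
    rw [← (mp i).map_eq]
    exact (integral_map (mp i).measurable.aemeasurable
      (hg.comp (measurable_id.sub_const a)).aestronglyMeasurable).symm
  have h0 (i : Fin m) : ∫ x, X i x ∂Q = 0 := by
    refine (hint measurable_id i).trans ?_
    simp only [id]
    rw [integral_sub i1 (integrable_const _)]
    simp [ha]
  refine ⟨?_, ?_, fun t => ?_⟩
  · rw [hμ, integral_map (by fun_prop) (by fun_prop)]
    simp_rw [hsum]
    have hv : Var[∑ i, X i; Q] = ∑ i, Var[X i; Q] :=
      IndepFun.variance_sum (fun i _ => (hX i).mono_exponent (by norm_num))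
        (fun i _ j _ hij => hind.indepFun hij)
    have hS : ∫ x, (∑ i, X i) x ∂Q = 0 := by
      simp only [Finset.sum_apply]
      rw [integral_finsetSum _ fun i _ => ?_]
      · simp [h0]
      · simpa using integrable_pow_of_memLp_three (hX i) (k := 1) (by norm_num)
    rw [variance_of_integral_eq_zero (by fun_prop) hS] at hv
    simp only [Finset.sum_apply] at hv
    rw [hv]
    have (i : Fin m) : Var[X i; Q] = ∫ x, (x - a) ^ 2 ∂ν := by
      rw [variance_of_integral_eq_zero (by fun_prop) (h0 i)]
      exact hint (g := fun x => x ^ 2) (by fun_prop) i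
    simp [this]
  · rw [hμ, integral_map (by fun_prop) (by fun_prop)]
    simp_rw [hsum]
    rw [integral_sum_pow_three hX hind h0]
    simp [hint (g := fun x => x ^ 3) (by fun_prop)]
  · rw [hμ, Measure.map_map (by fun_prop) hmeas]
    have : (fun y => y - m * a) ∘ (fun x : Fin m → ℝ => ∑ i, x i) = fun x => ∑ i, X i x := by
      ext x; exact hsum x
    rw [this, (hind.restrict _).charFun_map_fun_finsetSum_eq_prod
      (fun i _ => (hX i).aestronglyMeasurable.aemeasurable)]
    rw [Finset.prod_apply]
    have (i : Fin m) : Q.map (X i) = ν.map (fun x => x - a) := by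
      rw [← (mp i).map_eq, Measure.map_map (by fun_prop) (mp i).measurable]
      rfl
    simp [this]

/-- A non-negative infinitely divisible law with small third cumulant is almost normal: bound for
the distance of the characteristic functions. -/
theorem norm_charFun_centred_sub_exp_le {D : Measure ℝ} [IsProbabilityMeasure D]
    (hnn : ∀ᵐ x ∂D, 0 ≤ x) (hD : MemLp id 3 D) (hdiv : InfinitelyDivisible D) (t : ℝ) :
    ‖charFun (D.map (fun y => y - ∫ z, z ∂D)) t
        - Complex.exp (-((∫ y, (y - ∫ z, z ∂D) ^ 2 ∂D : ℝ) * t ^ 2 / 2))‖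
      ≤ 4 * |t| ^ 3 * ∫ y, (y - ∫ z, z ∂D) ^ 3 ∂D := by
  set μ := ∫ z, z ∂D with hμ
  set v := ∫ y, (y - μ) ^ 2 ∂D with hv
  set κ := ∫ y, (y - μ) ^ 3 ∂D with hκ
  set φ := charFun (D.map (fun y => y - μ)) t with hφ
  have hv0 : 0 ≤ v := integral_nonneg fun _ => sq_nonneg _
  -- The condition `v t² / 4 ≤ m` places `1 - v t² / (2m)` in `[-1, 1]`, as the comparison of powers
  -- requires.
  have key : ∀ m : ℕ, 0 < m → v * t ^ 2 / 4 ≤ m →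
      ‖φ - (1 + (-(v * t ^ 2 / 2) : ℂ) / m) ^ m‖ ≤ 4 * |t| ^ 3 * (κ + 2 * μ ^ 3 / m ^ 2) := by
    intro m hm hmt
    obtain ⟨ν, hν, hsum⟩ := hdiv m hm
    have hνnn : ∀ᵐ x ∂ν, 0 ≤ x := ae_nonneg_of_map_sum hm (hsum ▸ hnn)
    have hν3 : MemLp id 3 ν := memLp_of_map_sum hm hνnn (hsum ▸ hD)
    have h1 := integral_map_sum (m := m) hν3
    obtain ⟨h2, h3, h4⟩ := centred_map_sum (m := m) hν3
    rw [hsum] at h1 h2 h3 h4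
    rw [← hμ] at h1 h2 h3 h4
    specialize h4 t
    rw [← hv] at h2
    rw [← hκ] at h3
    rw [← hφ] at h4
    set a := ∫ x, x ∂ν with ha
    have hm' : (0 : ℝ) < m := by exact_mod_cast hm
    have hνa : MemLp (fun x => x - a) 3 ν := hν3.sub (memLp_const a)
    have i1 : Integrable (fun x : ℝ => x) ν := by
      simpa using integrable_pow_of_memLp_three hν3 (k := 1) (by norm_num)
    have h0 : ∫ x, (x - a) ∂ν = 0 := by
      rw [integral_sub i1 (integrable_const _)]
      simp [ha]
    have ha0 : 0 ≤ a := integral_nonneg_of_ae hνnn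
    -- Since `x ≥ 0`, a deviation below the mean is at most `a`, so passing to absolute values costs
    -- at most `2(a - x)^3 ≤ 2a^3`.
    have habs : ∫ x, |x - a| ^ 3 ∂ν ≤ ∫ x, (x - a) ^ 3 ∂ν + 2 * a ^ 3 := by
      have i3 := integrable_pow_of_memLp_three hνa le_rfl
      have : ∫ x, ((x - a) ^ 3 + 2 * a ^ 3) ∂ν = ∫ x, (x - a) ^ 3 ∂ν + 2 * a ^ 3 := by
        rw [integral_add i3 (integrable_const _)]; simp
      rw [← this]
      refine integral_mono_ae (integrable_abs_pow_three hνa) (i3.add (integrable_const _)) ?_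
      filter_upwards [hνnn] with x hx
      rcases le_total a x with h | h
      · rw [abs_of_nonneg (sub_nonneg.2 h)]
        have : 0 ≤ a ^ 3 := by positivity
        linarith
      · rw [abs_of_nonpos (sub_nonpos.2 h)]
        have : (a - x) ^ 3 ≤ a ^ 3 := by gcongr; linarith
        nlinarith
    have hT := norm_charFun_sub_le hνa h0 t
    have hpos : ∫ x, (x - a) ^ 2 ∂ν = v / m := by rw [h2]; field_simp
    have hb : (1 - ((∫ x, (x - a) ^ 2 ∂ν : ℝ) : ℂ) * t ^ 2 / 2)
        = 1 + (-(v * t ^ 2 / 2) : ℂ) / m := by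
      rw [hpos]; push_cast; ring
    rw [hb] at hT
    have : IsProbabilityMeasure (ν.map (fun x => x - a)) :=
      Measure.isProbabilityMeasure_map (by fun_prop)
    have hb1 : ‖(1 + (-(v * t ^ 2 / 2) : ℂ) / m)‖ ≤ 1 := by
      have e : (1 + (-(v * t ^ 2 / 2) : ℂ) / m) = ((1 - v * t ^ 2 / 2 / m : ℝ) : ℂ) := by
        push_cast; ring
      rw [e, Complex.norm_real, Real.norm_eq_abs, abs_le]
      have h5 : 0 ≤ v * t ^ 2 / 2 / m := by positivity
      have h6 : v * t ^ 2 / 2 / m ≤ 2 := by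
        rw [div_le_iff₀ hm']; linarith
      constructor <;> linarith
    rw [h4]
    refine (norm_pow_sub_pow_le_of_norm_le_one (norm_charFun_le_one t) hb1 m).trans ?_
    calc (m : ℝ) * _ ≤ m * (4 * |t| ^ 3 * (∫ x, (x - a) ^ 3 ∂ν + 2 * a ^ 3)) := by
          gcongr
          exact hT.trans (by gcongr)
      _ = 4 * |t| ^ 3 * (κ + 2 * μ ^ 3 / m ^ 2) := by
          rw [h3, h1]; field_simp
  -- `φ` does not depend on `m`, so the bound may be passed to the limit.
  have lim1 : Tendsto (fun m : ℕ => ‖φ - (1 + (-(v * t ^ 2 / 2) : ℂ) / m) ^ m‖) atTop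
      (𝓝 ‖φ - Complex.exp (-(v * t ^ 2 / 2))‖) :=
    (tendsto_const_nhds.sub (Complex.tendsto_one_add_div_pow_exp _)).norm
  have lim2 : Tendsto (fun m : ℕ => 4 * |t| ^ 3 * (κ + 2 * μ ^ 3 / (m : ℝ) ^ 2)) atTop
      (𝓝 (4 * |t| ^ 3 * κ)) := by
    have : Tendsto (fun m : ℕ => 2 * μ ^ 3 / (m : ℝ) ^ 2) atTop (𝓝 0) :=
      tendsto_const_nhds.div_atTop
        ((tendsto_pow_atTop two_ne_zero).comp tendsto_natCast_atTop_atTop)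
    simpa using (this.const_add κ).const_mul (4 * |t| ^ 3)
  refine le_of_tendsto_of_tendsto lim1 lim2 ?_
  filter_upwards [eventually_gt_atTop 0,
    tendsto_natCast_atTop_atTop.eventually_ge_atTop (v * t ^ 2 / 4)] with m hm hmt
  exact key m hm hmt

end InfinitelyDivisible

/-! ### Normalized variables and comparison of characteristic functions. -/

section Normalization

variable {Ω : Type*} [MeasurableSpace Ω] {P : Measure Ω} [IsProbabilityMeasure P]

/-- The distance of the characteristic function of a normalized non-negative infinitely divisible
variable to the standard normal one is controlled by the skewness. -/
theorem norm_charFun_normalized_sub_exp_le {Y : Ω → ℝ}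
    (hnn : ∀ᵐ w ∂P, 0 ≤ Y w) (hY : MemLp Y 3 P) (hdiv : InfinitelyDivisible (P.map Y))
    (hv : 0 < variance Y P) (s : ℝ) :
    ‖charFun (P.map (fun w => (Y w - ∫ w', Y w' ∂P) / √(variance Y P))) s
        - Complex.exp (-(s ^ 2 / 2))‖ ≤ 4 * |s| ^ 3 * skewness Y P := by
  have hm : AEMeasurable Y P := hY.aestronglyMeasurable.aemeasurable
  have : IsProbabilityMeasure (P.map Y) := Measure.isProbabilityMeasure_map hm
  have hnn' : ∀ᵐ x ∂(P.map Y), 0 ≤ x := (ae_map_iff hm measurableSet_Ici).2 hnn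
  have h3 : MemLp id 3 (P.map Y) := (memLp_map_measure_iff (by fun_prop) hm).2 hY
  set σ := √(variance Y P) with hσ
  have hσ0 : 0 < σ := Real.sqrt_pos.2 hv
  have hσ2 : σ ^ 2 = variance Y P := Real.sq_sqrt hv.le
  -- Evaluating at `s / σ` produces the factor `σ⁻³` that turns the third centred moment into the
  -- skewness.
  have key := norm_charFun_centred_sub_exp_le hnn' h3 hdiv (s / σ)
  rw [integral_map hm (by fun_prop)] at key
  set μ := ∫ w, Y w ∂P with hμ
  rw [integral_map hm (by fun_prop), integral_map hm (by fun_prop),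
    AEMeasurable.map_map_of_aemeasurable (by fun_prop) hm] at key
  have e1 : ∫ w, (Y w - μ) ^ 2 ∂P = σ ^ 2 := by rw [hσ2, variance_eq_integral hm]
  have e2 : charFun (P.map (fun w => (Y w - μ) / σ)) s
      = charFun (P.map ((fun y => y - μ) ∘ Y)) (s / σ) := by
    have := charFun_map_mul_comp (hm.sub_const μ) σ⁻¹ s
    simp_rw [inv_mul_eq_div] at this
    exact this
  have e3 : skewness Y P = (∫ w, (Y w - μ) ^ 3 ∂P) / σ ^ 3 := by
    simp only [skewness, div_pow, ← hμ, ← hσ]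
    rw [integral_div]
  have e4 : (((σ ^ 2 : ℝ) : ℂ) * ((s / σ : ℝ) : ℂ) ^ 2 / 2) = (s : ℂ) ^ 2 / 2 := by
    have : (σ : ℂ) ≠ 0 := by exact_mod_cast hσ0.ne'
    push_cast
    field_simp
  rw [e1, e4, ← e2] at key
  refine key.trans (le_of_eq ?_)
  rw [e3, abs_div, abs_of_pos hσ0]
  field_simp

/-- If `A` is within `δ` of `B` on `{|B| ≤ K}`, their characteristic functions are close. -/
lemma norm_charFun_sub_charFun_le {A B : Ω → ℝ} (hA : AEMeasurable A P) (hB : MemLp B 2 P)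
    {δ K : ℝ} (hδ : 0 ≤ δ) (hK : 0 < K) (h : ∀ w, |B w| ≤ K → |A w - B w| ≤ δ) (s : ℝ) :
    ‖charFun (P.map A) s - charFun (P.map B) s‖
      ≤ |s| * δ + 2 / K ^ 2 * ∫ w, B w ^ 2 ∂P := by
  have hBm : AEMeasurable B P := hB.aestronglyMeasurable.aemeasurable
  have e {C : Ω → ℝ} (hC : AEMeasurable C P) :
      charFun (P.map C) s = ∫ w, Complex.exp (Complex.I * (s * C w : ℝ)) ∂P := by
    rw [charFun_apply_real, integral_map hC (by fun_prop)]
    simp [mul_comm]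
  have ie {C : Ω → ℝ} (hC : AEMeasurable C P) :
      Integrable (fun w => Complex.exp (Complex.I * (s * C w : ℝ))) P := by
    refine (integrable_const (1 : ℝ)).mono' (by fun_prop) (ae_of_all _ fun w => ?_)
    rw [Complex.norm_exp_I_mul_ofReal]
  have i2 : Integrable (fun w => B w ^ 2) P := hB.integrable_sq
  have e2 : |s| * δ + 2 / K ^ 2 * ∫ w, B w ^ 2 ∂P
      = ∫ w, (|s| * δ + 2 / K ^ 2 * B w ^ 2) ∂P := by
    rw [integral_add (integrable_const _) (i2.const_mul _), integral_const_mul (2 / K ^ 2),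
      integral_const]
    simp only [probReal_univ, one_smul]
  rw [e hA, e hBm, ← integral_sub (ie hA) (ie hBm), e2]
  refine norm_integral_le_of_norm_le ((integrable_const _).add (i2.const_mul _))
    (ae_of_all _ fun w => ?_)
  -- Lipschitz bound inside; outside, the trivial bound 2 is at most `2 B² / K²`, as in Chebyshev's
  -- inequality.
  rcases le_or_gt |B w| K with hw | hw
  · have e3 : Complex.exp (Complex.I * (s * A w : ℝ)) - Complex.exp (Complex.I * (s * B w : ℝ))
        = Complex.exp (Complex.I * (s * B w : ℝ))
          * (Complex.exp (Complex.I * (s * (A w - B w) : ℝ)) - 1) := by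
      rw [mul_sub, ← Complex.exp_add]
      push_cast
      ring_nf
    rw [e3, norm_mul, Complex.norm_exp_I_mul_ofReal, one_mul]
    have h1 : ‖s * (A w - B w)‖ ≤ |s| * δ := by
      rw [norm_mul, Real.norm_eq_abs, Real.norm_eq_abs]
      gcongr
      exact h w hw
    have h2 : 0 ≤ 2 / K ^ 2 * B w ^ 2 := by positivity
    linarith [Real.norm_exp_I_mul_ofReal_sub_one_le (x := s * (A w - B w))]
  · have h1 : 2 ≤ 2 / K ^ 2 * B w ^ 2 := by
      rw [div_mul_eq_mul_div, le_div_iff₀ (by positivity), ← sq_abs (B w)]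
      gcongr
    have h2 : 0 ≤ |s| * δ := by positivity
    refine (norm_sub_le _ _).trans ?_
    rw [Complex.norm_exp_I_mul_ofReal, Complex.norm_exp_I_mul_ofReal]
    linarith

end Normalization

/-! ### Delta method for the logarithm. -/

/-- Linearization of the logarithm at `1`, at scale `v`. -/
lemma abs_inv_mul_log_sub_le {v r z K : ℝ} (hv : 0 < v) (hr : 0 ≤ r) (hz : |z| ≤ K)
    (hK : r * v * K ≤ 1 / 2) :
    |v⁻¹ * (Real.log (1 + r * v * z) + v ^ 2 / 2) - z|
      ≤ v / 2 + |r - 1| * K + 2 * r ^ 2 * v * K ^ 2 := by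
  set u := r * v * z with hu
  have hu1 : |u| ≤ r * v * K := by
    rw [hu, abs_mul, abs_of_nonneg (by positivity : 0 ≤ r * v)]
    gcongr
  -- The remainder is `u² / (1 - |u|)`, and `|u| ≤ 1/2` accounts for the factor 2 below.
  have h := Real.abs_log_sub_add_sum_range_le (x := -u) (by rw [abs_neg]; linarith) 1
  simp only [Finset.sum_range_one, abs_neg, sub_neg_eq_add] at h
  norm_num at h
  have h1 : |u| ^ 2 / (1 - |u|) ≤ 2 * (r * v * K) ^ 2 := by
    rw [div_le_iff₀ (by linarith)]
    have : |u| ^ 2 ≤ (r * v * K) ^ 2 := by gcongr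
    nlinarith [sq_nonneg (r * v * K)]
  rw [sq_abs] at h1
  have h2 : |Real.log (1 + u) - u| ≤ 2 * (r * v * K) ^ 2 := by
    rw [show Real.log (1 + u) - u = -u + Real.log (1 + u) by ring]
    exact h.trans h1
  have e : v⁻¹ * (Real.log (1 + u) + v ^ 2 / 2) - z
      = v⁻¹ * (Real.log (1 + u) - u) + (r - 1) * z + v / 2 := by
    rw [hu]; field_simp; ring
  rw [e]
  have h3 : |v⁻¹ * (Real.log (1 + u) - u)| ≤ 2 * r ^ 2 * v * K ^ 2 := by
    rw [abs_mul, abs_of_pos (inv_pos.2 hv)]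
    calc v⁻¹ * |Real.log (1 + u) - u| ≤ v⁻¹ * (2 * (r * v * K) ^ 2) := by gcongr
      _ = _ := by field_simp
  have h4 : |(r - 1) * z| ≤ |r - 1| * K := by rw [abs_mul]; gcongr
  have h5 : |v / 2| = v / 2 := abs_of_pos (by positivity)
  have := abs_add_three (v⁻¹ * (Real.log (1 + u) - u)) ((r - 1) * z) (v / 2)
  linarith

/-- Central limit theorem for the logarithm of a non-negative infinitely divisible variable whose
skewness tends to zero, with relative variance `~ v²`. -/
theorem tendsto_charFun_log {T : Type*} {l : Filter T} {v : T → ℝ} {b : ℝ}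
    {Ω : T → Type*} [∀ t, MeasurableSpace (Ω t)]
    {P : (t : T) → Measure (Ω t)} [∀ t, IsProbabilityMeasure (P t)] {Y : (t : T) → Ω t → ℝ}
    (hnn : ∀ t, ∀ᵐ w ∂(P t), 0 ≤ Y t w) (hY : ∀ t, MemLp (Y t) 3 (P t))
    (hdiv : ∀ t, InfinitelyDivisible ((P t).map (Y t)))
    (hskew : Tendsto (fun t => skewness (Y t) (P t)) l (𝓝 0))
    (hmean : ∀ t, 0 < ∫ w, Y t w ∂(P t))
    (hlog : ∀ t, Real.log (∫ w, Y t w ∂(P t)) = b + v t ^ 2 / 2)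
    (hv : ∀ t, 0 < v t) (hv0 : Tendsto (fun t => v t ^ 2) l (𝓝 0))
    (hvar : Tendsto
      (fun t => variance (Y t) (P t) / (v t ^ 2 * (∫ w, Y t w ∂(P t)) ^ 2)) l (𝓝 1)) (s : ℝ) :
    Tendsto (fun t => charFun ((P t).map (fun w => (v t)⁻¹ * (Real.log (Y t w) - b))) s) l
      (𝓝 (Complex.exp (-(s ^ 2 / 2)))) := by
  have hm (t : T) : AEMeasurable (Y t) (P t) := (hY t).aestronglyMeasurable.aemeasurable
  set E : T → ℝ := fun t => ∫ w, Y t w ∂(P t) with hE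
  set σ : T → ℝ := fun t => √(variance (Y t) (P t)) with hσ
  set r : T → ℝ := fun t => σ t / (v t * E t) with hr
  let Z : (t : T) → Ω t → ℝ := fun t w => (Y t w - E t) / σ t
  have hvt : Tendsto v l (𝓝 0) := by
    have := hv0.sqrt
    simpa [fun t => Real.sqrt_sq (hv t).le] using this
  have hrt : Tendsto r l (𝓝 1) := by
    have := hvar.sqrt
    rw [Real.sqrt_one] at this
    refine this.congr fun t => ?_
    rw [Real.sqrt_div (variance_nonneg _ _), ← mul_pow,
      Real.sqrt_sq (mul_pos (hv t) (hmean t)).le]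
  -- Zero variance would make the ratio in `hvar` equal to 0.
  have hvarpos : ∀ᶠ t in l, 0 < variance (Y t) (P t) := by
    filter_upwards [hvar.eventually (lt_mem_nhds one_pos)] with t ht
    refine (variance_nonneg _ _).lt_of_ne fun h => ?_
    rw [← h, zero_div] at ht
    exact lt_irrefl _ ht
  have hZ : Tendsto (fun t => charFun ((P t).map (Z t)) s) l
      (𝓝 (Complex.exp (-(s ^ 2 / 2)))) := by
    rw [tendsto_iff_norm_sub_tendsto_zero]
    have hb : Tendsto (fun t => 4 * |s| ^ 3 * skewness (Y t) (P t)) l (𝓝 0) := by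
      simpa using hskew.const_mul (4 * |s| ^ 3)
    refine squeeze_zero' (Eventually.of_forall fun t => norm_nonneg _) ?_ hb
    filter_upwards [hvarpos] with t ht
    exact norm_charFun_normalized_sub_exp_le (hnn t) (hY t) (hdiv t) ht s
  have hbound : ∀ K : ℝ, 0 < K → ∀ᶠ t in l,
      ‖charFun ((P t).map (fun w => (v t)⁻¹ * (Real.log (Y t w) - b))) s
          - charFun ((P t).map (Z t)) s‖
        ≤ |s| * (v t / 2 + |r t - 1| * K + 2 * r t ^ 2 * v t * K ^ 2) + 2 / K ^ 2 := by
    intro K hK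
    have hsmall : Tendsto (fun t => r t * v t * K) l (𝓝 0) := by
      simpa using (hrt.mul hvt).mul_const K
    filter_upwards [hvarpos, hsmall.eventually (gt_mem_nhds (by norm_num : (0 : ℝ) < 1 / 2))]
      with t ht htK
    have hσ0 : 0 < σ t := Real.sqrt_pos.2 ht
    have hr0 : 0 ≤ r t := (div_pos hσ0 (mul_pos (hv t) (hmean t))).le
    have hv' := hv t
    have hZ2 : MemLp (Z t) 2 (P t) := by
      have : MemLp (fun w => (Y t w - E t) * (σ t)⁻¹) 2 (P t) :=
        (((hY t).mono_exponent (by norm_num)).sub (memLp_const _)).mul_const _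
      simpa [Z, div_eq_mul_inv] using this
    have hZ1 : ∫ w, Z t w ^ 2 ∂(P t) = 1 := by
      simp only [Z, div_pow]
      rw [integral_div, ← variance_eq_integral (hm t), Real.sq_sqrt ht.le, div_self ht.ne']
    have := norm_charFun_sub_charFun_le (A := fun w => (v t)⁻¹ * (Real.log (Y t w) - b))
      (B := Z t) (δ := v t / 2 + |r t - 1| * K + 2 * r t ^ 2 * v t * K ^ 2) (K := K)
      (((Real.measurable_log.comp_aemeasurable (hm t)).sub_const b).const_mul _) hZ2
      (by positivity) hK ?_ s
    · rwa [hZ1, mul_one] at this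
    intro w hw
    have h1 : Y t w = E t * (1 + r t * v t * Z t w) := by
      have := (hmean t).ne'
      simp only [Z, hr]
      have h0 : E t ≠ 0 := this
      field_simp
      ring
    have h2 : |r t * v t * Z t w| ≤ r t * v t * K := by
      rw [abs_mul, abs_of_nonneg (by positivity : 0 ≤ r t * v t)]
      gcongr
    -- On `|Z| ≤ K` this forces `Y > 0`, so the value assigned to `log 0` plays no role there.
    have h3 : 0 < 1 + r t * v t * Z t w := by linarith [neg_abs_le (r t * v t * Z t w)]
    have h4 : Real.log (Y t w) - b = Real.log (1 + r t * v t * Z t w) + v t ^ 2 / 2 := by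
      rw [h1, Real.log_mul (hmean t).ne' h3.ne', hlog t]
      ring
    rw [h4]
    exact abs_inv_mul_log_sub_le hv' hr0 hw htK.le
  have hdiff : Tendsto (fun t => charFun ((P t).map (fun w => (v t)⁻¹ * (Real.log (Y t w) - b))) s
      - charFun ((P t).map (Z t)) s) l (𝓝 0) := by
    rw [Metric.tendsto_nhds]
    intro ε hε
    -- `K` is fixed first to control the tail; the linearization error then vanishes along `l`.
    obtain ⟨K, hK, hKε⟩ : ∃ K : ℝ, 0 < K ∧ 2 / K ^ 2 < ε / 2 := by
      have : Tendsto (fun K : ℝ => 2 / K ^ 2) atTop (𝓝 0) :=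
        tendsto_const_nhds.div_atTop (tendsto_pow_atTop two_ne_zero)
      exact ((eventually_gt_atTop 0).and (this.eventually (gt_mem_nhds (half_pos hε)))).exists
    have hδ : Tendsto (fun t => |s| * (v t / 2 + |r t - 1| * K + 2 * r t ^ 2 * v t * K ^ 2)) l
        (𝓝 0) := by
      have h1 : Tendsto (fun t => |r t - 1| * K) l (𝓝 0) := by
        simpa using ((hrt.sub_const 1).abs).mul_const K
      have h2 : Tendsto (fun t => 2 * r t ^ 2 * v t * K ^ 2) l (𝓝 0) := by
        simpa using ((((hrt.pow 2).const_mul 2).mul hvt).mul_const (K ^ 2))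
      simpa using (((hvt.div_const 2).add h1).add h2).const_mul |s|
    filter_upwards [hbound K hK, hδ.eventually (gt_mem_nhds (half_pos hε))] with t h1 h2
    rw [dist_zero_right]
    linarith
  simpa using hdiff.add hZ

/-! ### Joint Gaussian limit. -/

section StandardLimit

/-- Independent coordinates whose characteristic functions converge to the standard normal one
converge jointly to the standard Gaussian vector. -/
theorem tendstoInDistribution_stdGaussian {T ι : Type*} [Fintype ι] {l : Filter T}
    [l.IsCountablyGenerated] {Ω : T → Type*} [∀ t, MeasurableSpace (Ω t)]
    {P : (t : T) → Measure (Ω t)} [∀ t, IsProbabilityMeasure (P t)]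
    {e : (t : T) → ι → Ω t → ℝ} (hm : ∀ t i, AEMeasurable (e t i) (P t))
    (hind : ∀ t, iIndepFun (e t) (P t))
    (hlim : ∀ i s, Tendsto (fun t => charFun ((P t).map (e t i)) s) l
      (𝓝 (Complex.exp (-((s : ℂ) ^ 2 / 2))))) :
    TendstoInDistribution (fun t w => (WithLp.toLp 2 (fun i => e t i w) : EuclideanSpace ℝ ι))
      l id P (stdGaussian (EuclideanSpace ℝ ι)) where
  forall_aemeasurable t := by
    have := hm t
    fun_prop
  tendsto := by
    -- Countable generation of `l` reduces to sequences, where Lévy's continuity theorem applies.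
    refine tendsto_of_seq_tendsto fun u hu => ?_
    refine ProbabilityMeasure.tendsto_iff_tendsto_charFun.2 fun s => ?_
    change Tendsto (fun n => charFun ((P (u n)).map
      (fun w => (WithLp.toLp 2 (fun i => e (u n) i w) : EuclideanSpace ℝ ι))) s) atTop
      (𝓝 (charFun ((stdGaussian (EuclideanSpace ℝ ι)).map id) s))
    simp_rw [fun n => (iIndepFun_iff_charFun_pi (hm (u n))).1 (hind (u n)) s]
    rw [Measure.map_id, charFun_stdGaussian]
    have h : Complex.exp (-(‖s‖ : ℂ) ^ 2 / 2) = ∏ i, Complex.exp (-((s i : ℂ) ^ 2 / 2)) := by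
      rw [← Complex.exp_sum, ← Complex.ofReal_pow, EuclideanSpace.real_norm_sq_eq]
      push_cast
      rw [neg_div, Finset.sum_div, Finset.sum_neg_distrib]
    rw [h]
    exact tendsto_finsetProd _ fun i _ => (hlim i (s i)).comp hu

/-- Replaces the limit variable by the identity on its law, so that limits are stated through
explicit measures. -/
lemma TendstoInDistribution.id_of_map_eq {T E Ω' : Type*} {l : Filter T} {Ω : T → Type*}
    [∀ t, MeasurableSpace (Ω t)] {P : (t : T) → Measure (Ω t)} [∀ t, IsProbabilityMeasure (P t)]
    [TopologicalSpace E] [MeasurableSpace E] [OpensMeasurableSpace E] [MeasurableSpace Ω']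
    {μ' : Measure Ω'} [IsProbabilityMeasure μ'] {ν : Measure E} [IsProbabilityMeasure ν]
    {Z : Ω' → E} {X : (t : T) → Ω t → E} (h : TendstoInDistribution X l Z P μ')
    (hν : μ'.map Z = ν) : TendstoInDistribution X l id P ν where
  forall_aemeasurable := h.forall_aemeasurable
  tendsto := by
    have := h.tendsto
    simp only [hν] at this
    simpa only [Measure.map_id] using this

end StandardLimit

/-! ### Squared norm of a Gaussian vector. -/

section ChiSquared

variable {E : Type*} [NormedAddCommGroup E] [InnerProductSpace ℝ E] [FiniteDimensional ℝ E]
  [MeasurableSpace E] [BorelSpace E]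

lemma map_norm_sq_stdGaussian :
    (stdGaussian E).map (fun x => ‖x‖ ^ 2) = chiSquared (Module.finrank ℝ E) := by
  rw [stdGaussian, Measure.map_map (by fun_prop) (by fun_prop), chiSquared]
  congr 1
  ext x
  have h : ∑ i, x i • stdOrthonormalBasis ℝ E i
      = (stdOrthonormalBasis ℝ E).repr.symm (WithLp.toLp 2 x) := by
    rw [← OrthonormalBasis.sum_repr_symm]
  simp only [Function.comp_apply]
  rw [h, LinearIsometryEquiv.norm_map, EuclideanSpace.real_norm_sq_eq]

end ChiSquared

/-! ### Algebra and exact normal theory of least squares. -/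

section LinearAlgebra

variable {I : Finset (ℕ × ℕ)} {p : ℕ} {X : Matrix I (Fin p) ℝ}

/-- The likelihood depends on `ξ` only through `X *ᵥ ξ`. -/
lemma Identified.injective_mulVec (h : Identified X) : Function.Injective X.mulVec :=
  fun a b hab => h a b fun y v _ => by
    simp only [logLikelihood]
    rw [show X *ᵥ a = X *ᵥ b from hab]

lemma posDef_transpose_mul_self (hX : Function.Injective X.mulVec) : (Xᵀ * X).PosDef := by
  have := Matrix.PosDef.conjTranspose_mul_self X hX
  rwa [conjTranspose_eq_transpose_of_trivial] at this

lemma isUnit_det_transpose_mul_self (hX : Function.Injective X.mulVec) : IsUnit (Xᵀ * X).det :=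
  (Matrix.isUnit_iff_isUnit_det _).1 (posDef_transpose_mul_self hX).isUnit

/-- With `rss_add_smul`, this eliminates `ξ` and `ω` in favour of the normalized errors. -/
lemma lsEstimator_add_smul (hX : Function.Injective X.mulVec) (ξ : Fin p → ℝ) (v : ℝ)
    (e : I → ℝ) : lsEstimator X (X *ᵥ ξ + v • e) = ξ + v • lsEstimator X e := by
  simp only [lsEstimator, mulVec_add, mulVec_smul, mulVec_mulVec]
  rw [Matrix.nonsing_inv_mul _ (isUnit_det_transpose_mul_self hX), one_mulVec]

lemma rss_add_smul (hX : Function.Injective X.mulVec) (ξ : Fin p → ℝ) (v : ℝ) (e : I → ℝ) :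
    rss X (X *ᵥ ξ + v • e) = v ^ 2 * rss X e := by
  simp only [rss, residual, lsEstimator_add_smul hX, mulVec_add, mulVec_smul, Finset.mul_sum]
  refine Finset.sum_congr rfl fun i _ => ?_
  simp only [Pi.add_apply, Pi.smul_apply, smul_eq_mul]
  ring

/-- The orthogonal complement of the column space of the design matrix. -/
noncomputable def residualSpace (X : Matrix I (Fin p) ℝ) : Submodule ℝ (EuclideanSpace ℝ I) :=
  (LinearMap.range (Matrix.toLpLin 2 2 X))ᗮ

lemma finrank_residualSpace (hX : Function.Injective X.mulVec) :
    Module.finrank ℝ (residualSpace X) = I.card - p := by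
  have h := Submodule.finrank_add_finrank_orthogonal (LinearMap.range (Matrix.toLpLin 2 2 X))
  have hinj : Function.Injective (Matrix.toLpLin 2 2 X) := by
    intro a b hab
    have := congrArg WithLp.ofLp hab
    simp only [Matrix.ofLp_toLpLin, Matrix.toLin'_apply] at this
    exact WithLp.ofLp_injective 2 (hX this)
  rw [LinearMap.finrank_range_of_inj hinj] at h
  simp only [finrank_euclideanSpace, Fintype.card_fin, Fintype.card_coe] at h
  rw [residualSpace]
  lia

lemma toLp_mulVec_mem_range (X : Matrix I (Fin p) ℝ) (a : Fin p → ℝ) :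
    WithLp.toLp 2 (X *ᵥ a) ∈ LinearMap.range (Matrix.toLpLin 2 2 X) :=
  ⟨WithLp.toLp 2 a, by simp⟩

/-- These are the normal equations `X'(y - X ξ̂) = 0`. -/
lemma toLp_residual_mem (hX : Function.Injective X.mulVec) (y : I → ℝ) :
    WithLp.toLp 2 (residual X y) ∈ residualSpace X := by
  rw [residualSpace, Submodule.mem_orthogonal]
  rintro _ ⟨a, rfl⟩
  have h1 : residual X y = y - X *ᵥ lsEstimator X y := rfl
  have h2 : Xᵀ *ᵥ residual X y = 0 := by
    rw [h1, mulVec_sub, lsEstimator, mulVec_mulVec, mulVec_mulVec,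
      Matrix.mul_nonsing_inv _ (isUnit_det_transpose_mul_self hX), one_mulVec, sub_self]
  rw [EuclideanSpace.inner_eq_star_dotProduct]
  simp only [Matrix.ofLp_toLpLin, Matrix.toLin'_apply, star_trivial]
  rw [dotProduct_mulVec, ← mulVec_transpose, h2, zero_dotProduct]

lemma rss_eq_norm_sq (hX : Function.Injective X.mulVec) (y : I → ℝ) :
    rss X y = ‖(residualSpace X).orthogonalProjectionOnto (WithLp.toLp 2 y)‖ ^ 2 := by
  have h : (residualSpace X).starProjection (WithLp.toLp 2 y) = WithLp.toLp 2 (residual X y) := by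
    refine Submodule.eq_starProjection_of_mem_orthogonal (toLp_residual_mem hX y) ?_
    have : WithLp.toLp 2 y - WithLp.toLp 2 (residual X y)
        = WithLp.toLp 2 (X *ᵥ lsEstimator X y) := by
      ext i; simp [residual]
    rw [this, residualSpace]
    exact Submodule.le_orthogonal_orthogonal _ (toLp_mulVec_mem_range X _)
  rw [Submodule.coe_norm, ← Submodule.starProjection_apply, h, EuclideanSpace.real_norm_sq_eq]
  rfl

/-- Least squares for standard normal errors: the estimator is normal, and independent of the
projection on the residual space, which is standard normal. -/
theorem map_stdGaussian_lsEstimator_prod (hX : Function.Injective X.mulVec) :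
    (stdGaussian (EuclideanSpace ℝ I)).map
      (fun e => ((WithLp.toLp 2 (lsEstimator X e.ofLp) : EuclideanSpace ℝ (Fin p)),
        (residualSpace X).orthogonalProjectionOnto e))
      = (multivariateGaussian 0 (Xᵀ * X)⁻¹).prod (stdGaussian (residualSpace X)) := by
  have hpd := posDef_transpose_mul_self hX
  have hsymm : ((Xᵀ * X)⁻¹)ᵀ = (Xᵀ * X)⁻¹ := by
    rw [transpose_nonsing_inv, transpose_mul, transpose_transpose]
  have hG : Continuous (fun e : EuclideanSpace ℝ I =>
      ((WithLp.toLp 2 (lsEstimator X e.ofLp) : EuclideanSpace ℝ (Fin p)),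
        (residualSpace X).orthogonalProjectionOnto e)) := by
    unfold lsEstimator
    fun_prop
  have : IsProbabilityMeasure ((stdGaussian (EuclideanSpace ℝ I)).map
      (fun e => ((WithLp.toLp 2 (lsEstimator X e.ofLp) : EuclideanSpace ℝ (Fin p)),
        (residualSpace X).orthogonalProjectionOnto e))) :=
    Measure.isProbabilityMeasure_map hG.measurable.aemeasurable
  refine charFun_eq_prod_iff.1 fun t => ?_
  obtain ⟨⟨a, b⟩, rfl⟩ := WithLp.toLp_surjective 2 t
  -- `c` represents the functional `e ↦ ⟨ξ̂(e), a⟩`. It lies in the column space, hence is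
  -- orthogonal to `b`; Pythagoras then splits the exponent and gives independence.
  set c : EuclideanSpace ℝ I := WithLp.toLp 2 (X *ᵥ ((Xᵀ * X)⁻¹ *ᵥ a.ofLp)) with hc
  have hcb : inner ℝ c (b : EuclideanSpace ℝ I) = 0 :=
    (Submodule.mem_orthogonal _ _).1 b.2 c (toLp_mulVec_mem_range X _)
  have hcc : ‖c‖ ^ 2 = a.ofLp ⬝ᵥ (Xᵀ * X)⁻¹ *ᵥ a.ofLp := by
    rw [← real_inner_self_eq_norm_sq, EuclideanSpace.inner_eq_star_dotProduct]
    simp only [hc, star_trivial]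
    rw [dotProduct_mulVec, ← mulVec_transpose, mulVec_mulVec, mulVec_mulVec,
      Matrix.mul_nonsing_inv _ (isUnit_det_transpose_mul_self hX), one_mulVec]
  have hnorm : ‖c + b‖ ^ 2 = ‖c‖ ^ 2 + ‖b‖ ^ 2 := by
    rw [@norm_add_sq_real, hcb, Submodule.coe_norm]; ring
  have hinner (e : EuclideanSpace ℝ I) :
      inner ℝ (WithLp.toLp 2 (lsEstimator X e.ofLp) : EuclideanSpace ℝ (Fin p)) a
        + inner ℝ ((residualSpace X).orthogonalProjectionOnto e) b = inner ℝ e (c + b) := by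
    rw [inner_add_right]
    congr 1
    · rw [EuclideanSpace.inner_eq_star_dotProduct, EuclideanSpace.inner_eq_star_dotProduct]
      simp only [hc, star_trivial, lsEstimator]
      rw [dotProduct_mulVec, dotProduct_mulVec, ← mulVec_transpose, ← mulVec_transpose, hsymm,
        transpose_transpose]
    · exact Submodule.inner_orthogonalProjectionOnto_eq_of_mem_right b e
  rw [Measure.map_map (by fun_prop) hG.measurable, charFun_apply,
    integral_map (by fun_prop) (by fun_prop)]
  simp only [Function.comp_apply, WithLp.prod_inner_apply, hinner]
  rw [← charFun_apply, charFun_stdGaussian, charFun_stdGaussian,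
    charFun_multivariateGaussian hpd.inv.posSemidef, ← Complex.exp_add, ← Complex.ofReal_pow,
    hnorm, hcc]
  simp
  ring_nf

end LinearAlgebra

end GLN

/-! ### Assembly of the limits. -/

theorem theorem5
    {T : Type*} (l : Filter T) [l.IsCountablyGenerated]
    (I : Finset (ℕ × ℕ)) (p : ℕ)
    (X : Matrix I (Fin p) ℝ) (ξ : Fin p → ℝ) (ω : T → ℝ)
    {Ω : T → Type*} [∀ t, MeasurableSpace (Ω t)]
    (P : (t : T) → Measure (Ω t)) [∀ t, IsProbabilityMeasure (P t)]
    (Y : (t : T) → I → Ω t → ℝ)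
    (h : GLN.GeneralizedLogNormal l X ξ ω P Y) :
    -- the limit of the least squares estimator
    TendstoInDistribution
      (fun t (w : Ω t) =>
        (WithLp.toLp 2 ((ω t)⁻¹ • (GLN.lsEstimator X (GLN.logData (Y t) w) - ξ)) :
          EuclideanSpace ℝ (Fin p)))
      l id P (multivariateGaussian 0 (Xᵀ * X)⁻¹)
    ∧ (p < I.card →
      -- the limit of the variance estimator
      TendstoInDistribution
        (fun t (w : Ω t) => (ω t ^ 2)⁻¹ * GLN.sSquared X (GLN.logData (Y t) w))
        l id P (GLN.chiSquaredDiv (I.card - p))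
      -- joint convergence to independent limits
      ∧ TendstoInDistribution
        (fun t (w : Ω t) =>
          ((WithLp.toLp 2 ((ω t)⁻¹ • (GLN.lsEstimator X (GLN.logData (Y t) w) - ξ)) :
            EuclideanSpace ℝ (Fin p)),
            (ω t ^ 2)⁻¹ * GLN.sSquared X (GLN.logData (Y t) w)))
        l id P
        ((multivariateGaussian 0 (Xᵀ * X)⁻¹).prod (GLN.chiSquaredDiv (I.card - p)))) := by
  have hX := h.identified.injective_mulVec
  let e : (t : T) → I → Ω t → ℝ := fun t ij w => (ω t)⁻¹ * (Real.log (Y t ij w) - (X *ᵥ ξ) ij)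
  have hω (t : T) : ω t ≠ 0 := (h.omega_pos t).ne'
  have hg (t : T) (ij : I) : Measurable fun y => (ω t)⁻¹ * (Real.log y - (X *ᵥ ξ) ij) := by
    fun_prop
  have hdata (t : T) (w : Ω t) :
      GLN.logData (Y t) w = X *ᵥ ξ + ω t • (fun ij => e t ij w) := by
    ext ij
    simp [GLN.logData, e, hω t]
  have hls (t : T) (w : Ω t) : (ω t)⁻¹ • (GLN.lsEstimator X (GLN.logData (Y t) w) - ξ)
      = GLN.lsEstimator X (fun ij => e t ij w) := by
    rw [hdata, GLN.lsEstimator_add_smul hX, add_sub_cancel_left, inv_smul_smul₀ (hω t)]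
  have hs (t : T) (w : Ω t) : (ω t ^ 2)⁻¹ * GLN.sSquared X (GLN.logData (Y t) w)
      = GLN.sSquared X (fun ij => e t ij w) := by
    rw [GLN.sSquared, hdata, GLN.rss_add_smul hX, GLN.sSquared, mul_div_assoc,
      inv_mul_cancel_left₀ (pow_ne_zero 2 (hω t))]
  simp_rw [hls, hs]
  have hlim := GLN.tendstoInDistribution_stdGaussian (l := l) (P := P) (e := e)
    (fun t ij => (hg t ij).comp_aemeasurable (h.aemeasurable t ij))
    (fun t => (h.indep t).comp _ (hg t))
    (fun ij s => GLN.tendsto_charFun_log (fun t => h.nonneg t ij) (fun t => h.memLp_three t ij)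
      (fun t => h.infDiv t ij) (h.skewness_tendsto ij) (fun t => h.mean_pos t ij)
      (fun t => h.log_mean t ij) h.omega_pos h.omega_tendsto (h.variance_tendsto ij) s)
  have hG : Continuous (fun e : EuclideanSpace ℝ I =>
      ((WithLp.toLp 2 (GLN.lsEstimator X e.ofLp) : EuclideanSpace ℝ (Fin p)),
        (GLN.residualSpace X).orthogonalProjectionOnto e)) := by
    unfold GLN.lsEstimator
    fun_prop
  have hjoint := GLN.TendstoInDistribution.id_of_map_eq (hlim.continuous_comp hG)
    (GLN.map_stdGaussian_lsEstimator_prod hX)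
  refine ⟨?_, fun hp => ?_⟩
  -- Valid for `n = p` too: the residual space is then trivial.
  · exact GLN.TendstoInDistribution.id_of_map_eq (hjoint.continuous_comp (g := Prod.fst) continuous_fst)
      measurePreserving_fst.map_eq
  -- `p < n` makes the truncated subtraction `I.card - p` agree with the real denominator.
  have hchi : (stdGaussian (GLN.residualSpace X)).map (fun x => ‖x‖ ^ 2 / ((I.card : ℝ) - p))
      = GLN.chiSquaredDiv (I.card - p) := by
    rw [GLN.chiSquaredDiv, ← GLN.finrank_residualSpace hX, ← GLN.map_norm_sq_stdGaussian,
      Measure.map_map (by fun_prop) (by fun_prop), GLN.finrank_residualSpace hX,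
      Nat.cast_sub hp.le]
    rfl
  have hpair := GLN.TendstoInDistribution.id_of_map_eq (Z := Prod.map id
      (fun x : GLN.residualSpace X => ‖x‖ ^ 2 / ((I.card : ℝ) - p)))
    (ν := (multivariateGaussian 0 (Xᵀ * X)⁻¹).prod (GLN.chiSquaredDiv (I.card - p)))
    (hjoint.continuous_comp (g := Prod.map id
      (fun x : GLN.residualSpace X => ‖x‖ ^ 2 / ((I.card : ℝ) - p))) (by fun_prop))
    (by rw [← Measure.map_prod_map _ _ measurable_id (by fun_prop), hchi, Measure.map_id])
  have hfun (t : T) (w : Ω t) : GLN.sSquared X (fun ij => e t ij w)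
      = ‖(GLN.residualSpace X).orthogonalProjectionOnto (WithLp.toLp 2 (fun ij => e t ij w))‖ ^ 2
        / ((I.card : ℝ) - p) := by
    rw [GLN.sSquared, GLN.rss_eq_norm_sq hX]
  simp_rw [hfun]
  exact ⟨GLN.TendstoInDistribution.id_of_map_eq (hpair.continuous_comp (g := Prod.snd) continuous_snd)
    measurePreserving_snd.map_eq, hpair⟩
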